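/- For $A\in\mathbf M_n(\mathbb C)$ and $1\le k\le n$, the rank-$k$ numerical range $\Lambda_k(A)$ is the set of all $\lambda\in\mathbb C$ for which there is an orthogonal projection $P\in\mathbf M_n(\mathbb C)$ of rank $k$ with $PAP=\lambda P$. (i) Let $b,c\ge 0$ with $b^2+c^2=1$, and let $A\in\mathbf M_4(\mathbb C)$ be unitarily similar to $$\begin{bmatrix} 0&0&1&0\\ 0&0&0&b\\ 0&0&0&c\\ 0&0&0&0\end{bmatrix}.$$ Then $\Lambda_2(A)$ is the closed disk centered at the origin of radius $$r_2=\sqrt{\tfrac14-\sqrt{\tfrac1{16}-\tfrac{b^2}{16}}}$$ (a single point if $b=0$), and, if $b\neq 0$, $\Lambda_3(A)=\emptyset$. (ii) Let $b,c,s,t\ge 0$ with $s^2+t^2=b^2+c^2=1$ and $bcst=0$, and let $A\in\mathbf M_5(\mathbb C)$ be unitarily similar to $$\begin{bmatrix} 0&0&1&0&0\\ 0&0&0&b&tc\\ 0&0&0&c&-tb\\ 0&0&0&0&s\\ 0&0&0&0&0\end{bmatrix}.$$ Then $\Lambda_2(A)$ is the closed disk centered at the origin of radius $$r_-=\frac12\sqrt{\frac{3-\sqrt{5-4(b^2+c^2t^2)}}{2}},$$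 $\Lambda_3(A)=\{0\}$, and $\Lambda_4(A)=\emptyset$. -/

import Mathlib

/-- The rank-`k` numerical range of `A`: all `z` such that `P A P = z P` for some orthogonal
projection `P` (self-adjoint idempotent matrix) of rank `k`. -/
def rankNumericalRange {n : ℕ} (k : ℕ) (A : Matrix (Fin n) (Fin n) ℂ) : Set ℂ :=
  {z | ∃ P : Matrix (Fin n) (Fin n) ℂ, IsStarProjection P ∧ P.rank = k ∧ P * A * P = z • P}

/-- `A` is unitarily similar to `M`: `A = U⋆ M U` for some unitary matrix `U`. -/
def UnitarilySimilar {n : ℕ} (A M : Matrix (Fin n) (Fin n) ℂ) : Prop :=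
  ∃ U ∈ Matrix.unitaryGroup (Fin n) ℂ, A = star U * M * U

/-- The canonical form of a 4-by-4 nilpotent partial isometry of rank two. -/
def nilpotentFour (b c : ℝ) : Matrix (Fin 4) (Fin 4) ℂ :=
  !![0, 0, 1, 0;
     0, 0, 0, (b : ℂ);
     0, 0, 0, (c : ℂ);
     0, 0, 0, 0]

/-- The canonical form of a 5-by-5 nilpotent partial isometry of rank three. -/
def nilpotentFive (b c s t : ℝ) : Matrix (Fin 5) (Fin 5) ℂ :=
  !![0, 0, 1, 0, 0;
     0, 0, 0, (b : ℂ), (t : ℂ) * (c : ℂ);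
     0, 0, 0, (c : ℂ), -((t : ℂ) * (b : ℂ));
     0, 0, 0, 0, (s : ℂ);
     0, 0, 0, 0, 0]

/-!
The basis vectors can be given degrees so that every nonzero entry of the matrix raises the degree
by one. Diagonal unitaries then rotate the matrix by arbitrary phases, each `Λ_k` is circularly
symmetric, and only its real points matter. If `z ∈ Λ_k(A)`, then `A + Aᴴ` has the constant value
`2 * z.re` on the unit sphere of a `k`-dimensional subspace, which meets the span of all but the
`k - 1` top eigenvectors; hence `2 * z.re` is at most the `k`-th largest eigenvalue of `A + Aᴴ`.
These eigenvalues are explicit and give the radii.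

Conversely, for real `x` between `0` and the radius of `Λ_2`, a plane on which the compression is
`x` is spanned by two explicit vectors depending on a parameter, which solves a quadratic equation
whose discriminant is nonnegative in this range. For the `5 × 5` matrices, `b c s t = 0` leaves
three cases: if `c s = 0`, the matrix compresses to the `4 × 4` one with `b = 1`; if `t = 0`, the
plane is explicit; and `b = 0` is, up to an adjoint, the case `t = 0`.
-/

open Matrix Module Polynomial
open scoped InnerProductSpace

section General

variable {n m k : ℕ} {A M : Matrix (Fin n) (Fin n) ℂ} {z : ℂ}

theorem mem_rankNumericalRange_iff_exists_submodule :
    z ∈ rankNumericalRange k A ↔ ∃ S : Submodule ℂ (EuclideanSpace ℂ (Fin n)),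
      finrank ℂ S = k ∧
        ∀ v ∈ S, ∀ w ∈ S, ⟪v, toEuclideanCLM (n := Fin n) (𝕜 := ℂ) A w⟫_ℂ = z * ⟪v, w⟫_ℂ := by
  let φ := toEuclideanCLM (n := Fin n) (𝕜 := ℂ)
  have rank_eq (P : Matrix (Fin n) (Fin n) ℂ) (S : Submodule ℂ (EuclideanSpace ℂ (Fin n)))
      (hP : φ P = S.starProjection) : P.rank = finrank ℂ S := by
    rw [P.rank_eq_finrank_range_toLin (PiLp.basisFun 2 ℂ (Fin n)) (PiLp.basisFun 2 ℂ (Fin n)),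
      ← toLpLin_eq_toLin, ← S.range_starProjection, ← hP]
    rfl
  constructor
  · rintro ⟨P, hP, hrank, hPAP⟩
    obtain ⟨S, _, hS⟩ := isStarProjection_iff_eq_starProjection.1 (hP.map φ)
    refine ⟨S, (rank_eq P S hS).symm.trans hrank, fun v hv w hw => ?_⟩
    have hφ := congrArg (fun B => ⟪v, φ B w⟫_ℂ) hPAP
    simpa only [map_mul, map_smul, hS, mul_apply_eq_comp, _root_.smul_apply,
      ← S.inner_starProjection_left_eq_right, Submodule.starProjection_eq_self_iff.2 hv,
      Submodule.starProjection_eq_self_iff.2 hw, inner_smul_right] using hφ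
  · rintro ⟨S, hS, hform⟩
    obtain ⟨P, hP⟩ := EquivLike.surjective φ S.starProjection
    have hproj : IsStarProjection (φ P) := hP ▸ isStarProjection_starProjection
    refine ⟨P, ⟨?_, ?_⟩, (rank_eq P S hP).trans hS, EquivLike.injective φ ?_⟩
    · exact EquivLike.injective φ ((map_mul φ P P).trans hproj.isIdempotentElem.eq)
    · exact EquivLike.injective φ ((map_star φ P).trans hproj.isSelfAdjoint.star_eq)
    ext1 w
    refine ext_inner_left ℂ fun v => ?_
    have h := hform _ (S.starProjection_apply_mem v) _ (S.starProjection_apply_mem w)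
    simpa only [map_mul, map_smul, hP, mul_apply_eq_comp, _root_.smul_apply, inner_smul_right,
      S.inner_starProjection_left_eq_right,
      Submodule.starProjection_eq_self_iff.2 (S.starProjection_apply_mem w)] using h

theorem rankNumericalRange_conjTranspose_mul_mul_subset {V : Matrix (Fin n) (Fin m) ℂ}
    (hV : Vᴴ * V = 1) : rankNumericalRange k (Vᴴ * A * V) ⊆ rankNumericalRange k A := by
  rintro z ⟨P, hP, hrank, hPAP⟩
  have hPH : Pᴴ = P := hP.isSelfAdjoint
  have hVPV : Vᴴ * (V * P * Vᴴ) * V = P := by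
    rw [show Vᴴ * (V * P * Vᴴ) * V = Vᴴ * V * P * (Vᴴ * V) by simp only [Matrix.mul_assoc], hV,
      Matrix.one_mul, Matrix.mul_one]
  refine ⟨V * P * Vᴴ, ⟨?_, ?_⟩, ?_, ?_⟩
  · calc V * P * Vᴴ * (V * P * Vᴴ) = V * P * (Vᴴ * V) * P * Vᴴ := by simp only [Matrix.mul_assoc]
      _ = V * (P * P) * Vᴴ := by rw [hV, Matrix.mul_one, Matrix.mul_assoc V]
      _ = V * P * Vᴴ := by rw [hP.isIdempotentElem.eq]
  · rw [IsSelfAdjoint, star_eq_conjTranspose, conjTranspose_mul, conjTranspose_mul,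
      conjTranspose_conjTranspose, hPH, Matrix.mul_assoc]
  · refine le_antisymm ?_ ?_
    · exact ((rank_mul_le_left _ _).trans (rank_mul_le_right _ _)).trans_eq hrank
    · rw [← hrank]
      nth_rw 1 [← hVPV]
      exact (rank_mul_le_left _ _).trans (rank_mul_le_right _ _)
  · calc V * P * Vᴴ * A * (V * P * Vᴴ) = V * (P * (Vᴴ * A * V) * P) * Vᴴ := by
          simp only [Matrix.mul_assoc]
      _ = z • (V * P * Vᴴ) := by rw [hPAP, Matrix.mul_smul, Matrix.smul_mul]

theorem UnitarilySimilar.symm (h : UnitarilySimilar A M) : UnitarilySimilar M A := by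
  obtain ⟨U, hU, rfl⟩ := h
  refine ⟨star U, Unitary.star_mem hU, ?_⟩
  rw [star_star, show U * (star U * M * U) * star U = U * star U * M * (U * star U) by
    simp only [Matrix.mul_assoc], Unitary.mul_star_self_of_mem hU, Matrix.one_mul, Matrix.mul_one]

theorem UnitarilySimilar.rankNumericalRange_subset (h : UnitarilySimilar A M) :
    rankNumericalRange k A ⊆ rankNumericalRange k M := by
  obtain ⟨U, hU, rfl⟩ := h
  exact rankNumericalRange_conjTranspose_mul_mul_subset (Unitary.star_mul_self_of_mem hU)

theorem UnitarilySimilar.rankNumericalRange_eq (h : UnitarilySimilar A M) :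
    rankNumericalRange k A = rankNumericalRange k M :=
  h.rankNumericalRange_subset.antisymm h.symm.rankNumericalRange_subset

theorem smul_mem_rankNumericalRange_smul (w : ℂ) (hz : z ∈ rankNumericalRange k A) :
    w * z ∈ rankNumericalRange k (w • A) := by
  obtain ⟨P, hP, hrank, hPAP⟩ := hz
  exact ⟨P, hP, hrank, by rw [mul_smul_comm, smul_mul_assoc, hPAP, smul_smul]⟩

theorem star_mem_rankNumericalRange_conjTranspose (hz : z ∈ rankNumericalRange k A) :
    star z ∈ rankNumericalRange k Aᴴ := by
  obtain ⟨P, hP, hrank, hPAP⟩ := hz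
  have hPH : Pᴴ = P := hP.isSelfAdjoint
  refine ⟨P, hP, hrank, ?_⟩
  simpa only [conjTranspose_mul, conjTranspose_smul, hPH, Matrix.mul_assoc] using
    congrArg conjTranspose hPAP

theorem mem_rankNumericalRange_of_orthogonal {u : Fin k → Fin n → ℂ} (hu : ∀ i, u i ≠ 0)
    (horth : Pairwise fun i j => star (u i) ⬝ᵥ u j = 0)
    (hform : ∀ i j, star (u i) ⬝ᵥ A *ᵥ u j = z * (star (u i) ⬝ᵥ u j)) :
    z ∈ rankNumericalRange k A := by
  have inner_toLp (x y : Fin n → ℂ) : ⟪WithLp.toLp 2 x, WithLp.toLp 2 y⟫_ℂ = star x ⬝ᵥ y := by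
    rw [EuclideanSpace.inner_toLp_toLp, dotProduct_comm]
  have hlin : LinearIndependent ℂ fun i => WithLp.toLp 2 (u i) :=
    linearIndependent_of_ne_zero_of_inner_eq_zero
      (fun i => by simpa only [ne_eq, WithLp.toLp_eq_zero] using hu i)
      fun i j hij => (inner_toLp _ _).trans (horth hij)
  refine mem_rankNumericalRange_iff_exists_submodule.2
    ⟨Submodule.span ℂ (Set.range fun i => WithLp.toLp 2 (u i)),
      (finrank_span_eq_card hlin).trans (Fintype.card_fin k), fun v hv w hw => ?_⟩
  induction hv, hw using Submodule.span_induction₂ with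
  | mem_mem v w hv hw =>
    obtain ⟨⟨i, rfl⟩, j, rfl⟩ := hv, hw
    rw [toEuclideanCLM_toLp, inner_toLp, inner_toLp, hform]
  | zero_left => simp only [inner_zero_left, mul_zero]
  | zero_right => simp only [map_zero, inner_zero_right, mul_zero]
  | add_left u v w _ _ _ hu hv => rw [inner_add_left, inner_add_left, hu, hv, mul_add]
  | add_right u v w _ _ _ hv hw => rw [map_add, inner_add_right, inner_add_right, hv, hw, mul_add]
  | smul_left a v w _ _ h => rw [inner_smul_left, inner_smul_left, h, mul_left_comm]
  | smul_right a v w _ _ h => rw [map_smul, inner_smul_right, inner_smul_right, h, mul_left_comm]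

theorem zero_mem_rankNumericalRange_of_submatrix_eq_zero {f : Fin k → Fin n}
    (hf : Function.Injective f) (h : A.submatrix f f = 0) : 0 ∈ rankNumericalRange k A := by
  refine mem_rankNumericalRange_of_orthogonal (u := fun i => Pi.single (f i) 1)
    (fun i => by simp) (fun i j hij => ?_) fun i j => ?_
  · simp [Pi.star_single, hf.ne hij.symm]
  · simpa [Pi.star_single] using congrFun₂ h i j

theorem ofReal_mem_rankNumericalRange_two_of_orthogonal {M : Matrix (Fin n) (Fin n) ℝ} {x : ℝ}
    {v w : Fin n → ℝ} (hv : v ≠ 0) (hw : w ≠ 0) (hvw : v ⬝ᵥ w = 0)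
    (hvv : v ⬝ᵥ M *ᵥ v = x * (v ⬝ᵥ v)) (hww : w ⬝ᵥ M *ᵥ w = x * (w ⬝ᵥ w))
    (hMvw : v ⬝ᵥ M *ᵥ w = 0) (hMwv : w ⬝ᵥ M *ᵥ v = 0) :
    (x : ℂ) ∈ rankNumericalRange 2 (M.map Complex.ofReal) := by
  have star_ofReal (p : Fin n → ℝ) : star (Complex.ofReal ∘ p) = Complex.ofReal ∘ p := by
    ext i; simp
  have dot_ofReal (p q : Fin n → ℝ) :
      (Complex.ofReal ∘ p) ⬝ᵥ (Complex.ofReal ∘ q) = ((p ⬝ᵥ q : ℝ) : ℂ) :=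
    (RingHom.map_dotProduct Complex.ofRealHom p q).symm
  have mulVec_ofReal (q : Fin n → ℝ) :
      M.map Complex.ofReal *ᵥ (Complex.ofReal ∘ q) = Complex.ofReal ∘ (M *ᵥ q) := by
    ext i; exact (RingHom.map_mulVec Complex.ofRealHom M q i).symm
  refine mem_rankNumericalRange_of_orthogonal (u := fun i => Complex.ofReal ∘ ![v, w] i)
    (fun i h => ?_) (fun i j hij => ?_) fun i j => ?_
  · have : ![v, w] i = 0 := by
      ext l; simpa using congrFun h l
    fin_cases i
    exacts [hv this, hw this]
  · beta_reduce
    rw [star_ofReal, dot_ofReal, Complex.ofReal_eq_zero]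
    fin_cases i <;> fin_cases j
    exacts [absurd rfl hij, hvw, (dotProduct_comm w v).trans hvw, absurd rfl hij]
  · rw [star_ofReal, mulVec_ofReal, dot_ofReal, dot_ofReal, ← Complex.ofReal_mul,
      Complex.ofReal_inj]
    fin_cases i <;> fin_cases j
    · exact hvv
    · exact hMvw.trans (by simp [hvw])
    · exact hMwv.trans (by simp [dotProduct_comm w v, hvw])
    · exact hww

/-- A matrix is graded by `d` if each of its nonzero entries raises the degree `d` of the basis
vectors by one. Conjugating by the diagonal unitary matrix of the `w ^ d i` then multiplies the
matrix by the phase `w`, so that the rank-`k` numerical ranges are circularly symmetric. -/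
def IsGradedBy (M : Matrix (Fin n) (Fin n) ℂ) (d : Fin n → ℕ) : Prop :=
  ∀ i j, M i j ≠ 0 → d j = d i + 1

namespace IsGradedBy

variable {d : Fin n → ℕ}

theorem unitarilySimilar_smul (h : IsGradedBy M d) {w : ℂ} (hw : star w * w = 1) :
    UnitarilySimilar (w • M) M := by
  refine ⟨diagonal fun i => w ^ d i, ?_, ?_⟩
  · rw [mem_unitaryGroup_iff', star_eq_conjTranspose, diagonal_conjTranspose,
      diagonal_mul_diagonal, ← diagonal_one]
    congr 1 with i
    rw [Pi.star_apply, star_pow, ← mul_pow, hw, one_pow]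
  · ext i j
    rw [star_eq_conjTranspose, diagonal_conjTranspose, mul_diagonal, diagonal_mul,
      Matrix.smul_apply, smul_eq_mul, Pi.star_apply, star_pow]
    by_cases hij : M i j = 0
    · rw [hij, mul_zero, mul_zero, zero_mul]
    · calc w * M i j = (star w * w) ^ d i * w * M i j := by rw [hw, one_pow, one_mul]
        _ = star w ^ d i * M i j * w ^ d j := by rw [h i j hij]; ring

theorem smul_mem (h : IsGradedBy M d) {w : ℂ} (hw : star w * w = 1)
    (hz : z ∈ rankNumericalRange k M) : w * z ∈ rankNumericalRange k M := by
  rw [← (h.unitarilySimilar_smul hw).rankNumericalRange_eq]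
  exact smul_mem_rankNumericalRange_smul w hz

theorem ofReal_norm_mem_iff (h : IsGradedBy M d) :
    (‖z‖ : ℂ) ∈ rankNumericalRange k M ↔ z ∈ rankNumericalRange k M := by
  obtain ⟨w, hw, hwz⟩ : ∃ w : ℂ, star w * w = 1 ∧ w * ‖z‖ = z := by
    refine ⟨Complex.exp (z.arg * Complex.I), ?_, ?_⟩
    · rw [Complex.star_def, Complex.conj_mul', Complex.norm_exp_ofReal_mul_I, Complex.ofReal_one,
        one_pow]
    · rw [mul_comm, Complex.norm_mul_exp_arg_mul_I]
  refine ⟨fun hm => hwz ▸ h.smul_mem hw hm, fun hm => ?_⟩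
  have hw' : star w * z = ‖z‖ := by
    nth_rw 1 [← hwz]
    rw [← mul_assoc, hw, one_mul]
  exact hw' ▸ h.smul_mem (by rw [star_star, mul_comm, hw]) hm

theorem rankNumericalRange_eq_closedBall (h : IsGradedBy M d) {r : ℝ}
    (hle : ∀ z ∈ rankNumericalRange k M, z.re ≤ r)
    (hmem : ∀ x : ℝ, 0 ≤ x → x ≤ r → (x : ℂ) ∈ rankNumericalRange k M) :
    rankNumericalRange k M = Metric.closedBall 0 r := by
  ext z
  rw [mem_closedBall_zero_iff, ← h.ofReal_norm_mem_iff]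
  exact ⟨hle _, hmem _ (norm_nonneg z)⟩

theorem rankNumericalRange_eq_empty (h : IsGradedBy M d)
    (hlt : ∀ z ∈ rankNumericalRange k M, z.re < 0) : rankNumericalRange k M = ∅ :=
  Set.eq_empty_of_forall_notMem fun z hz =>
    (hlt _ (h.ofReal_norm_mem_iff.2 hz)).not_ge (norm_nonneg z)

end IsGradedBy

section UpperBound

variable {𝕜 E ι : Type*} [RCLike 𝕜] [NormedAddCommGroup E] [InnerProductSpace 𝕜 E] [Fintype ι]

theorem le_of_card_eigenvalues_lt_finrank {T : E →ₗ[𝕜] E} (v : OrthonormalBasis ι 𝕜 E)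
    {lam : ι → ℝ} (hv : ∀ i, T (v i) = (lam i : 𝕜) • v i) {S : Submodule 𝕜 E} {r μ : ℝ}
    (hcard : Fintype.card {i // r < lam i} < finrank 𝕜 S)
    (hμ : ∀ w ∈ S, μ * ‖w‖ ^ 2 ≤ RCLike.re ⟪w, T w⟫_𝕜) : μ ≤ r := by
  have : FiniteDimensional 𝕜 E := v.toBasis.finiteDimensional_of_finite
  let coords : S →ₗ[𝕜] {i // r < lam i} → 𝕜 :=
    LinearMap.pi fun i => (innerₛₗ 𝕜 (v i)).comp S.subtype
  obtain ⟨⟨w, hwS⟩, hw, hw0⟩ : ∃ w ∈ LinearMap.ker coords, w ≠ 0 :=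
    Submodule.exists_mem_ne_zero_of_ne_bot
      (LinearMap.ker_ne_bot_of_finrank_lt (by rwa [finrank_fintype_fun_eq_card]))
  have hcoord (i) (hi : r < lam i) : ⟪v i, w⟫_𝕜 = 0 := congrFun hw ⟨i, hi⟩
  have hTw : T w = ∑ i, (⟪v i, w⟫_𝕜 * lam i) • v i := by
    conv_lhs => rw [← v.sum_repr' w]
    simp only [map_sum, map_smul, hv, smul_smul]
  have hre : RCLike.re ⟪w, T w⟫_𝕜 = ∑ i, lam i * ‖⟪v i, w⟫_𝕜‖ ^ 2 := by
    rw [hTw, inner_sum, map_sum]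
    refine Finset.sum_congr rfl fun i _ => ?_
    rw [inner_smul_right, mul_right_comm, mul_comm _ (lam i : 𝕜), RCLike.re_ofReal_mul,
      inner_mul_symm_re_eq_norm, norm_mul, norm_inner_symm w, sq]
  have hle : RCLike.re ⟪w, T w⟫_𝕜 ≤ r * ‖w‖ ^ 2 := by
    rw [hre, ← v.sum_sq_norm_inner_right w, Finset.mul_sum]
    refine Finset.sum_le_sum fun i _ => ?_
    rcases lt_or_ge r (lam i) with hi | hi
    · simp [hcoord i hi]
    · gcongr
  exact le_of_mul_le_mul_right ((hμ w hwS).trans hle)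
    (pow_pos (norm_pos_iff.2 fun h => hw0 (Subtype.ext h)) 2)

end UpperBound

theorem card_eigenvalues_gt_le {H : Matrix (Fin n) (Fin n) ℂ} (hH : H.IsHermitian)
    {lam : Fin n → ℝ} (hlam : Antitone lam) (hchar : H.charpoly = ∏ j, (X - C (lam j : ℂ)))
    (i : Fin n) : Fintype.card {j // lam i < hH.eigenvalues j} ≤ i := by
  have hroots : Finset.univ.val.map hH.eigenvalues = Finset.univ.val.map lam := by
    refine Multiset.map_injective Complex.ofReal_injective ?_
    have h := hH.roots_charpoly_eq_eigenvalues
    rw [hchar, Finset.prod_eq_multiset_prod, ← Function.comp_def (fun a : ℂ => X - C a),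
      ← Multiset.map_map, roots_multiset_prod_X_sub_C] at h
    rw [Multiset.map_map, Multiset.map_map]
    exact h.symm
  calc Fintype.card {j // lam i < hH.eigenvalues j}
      = (Finset.univ.val.map hH.eigenvalues).countP (lam i < ·) := by
        rw [Fintype.card_subtype, Multiset.countP_map]; rfl
    _ = (Finset.univ.filter (lam i < lam ·)).card := by
        rw [hroots, Multiset.countP_map]; rfl
    _ ≤ (Finset.Iio i).card := Finset.card_le_card fun j hj =>
        Finset.mem_Iio.2 (hlam.reflect_lt (Finset.mem_filter.1 hj).2)
    _ = i := Fin.card_Iio i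

theorem two_mul_re_le_of_mem_rankNumericalRange {lam : Fin n → ℝ} (hlam : Antitone lam)
    (hchar : (A + Aᴴ).charpoly = ∏ j, (X - C (lam j : ℂ))) {i : Fin n}
    (hz : z ∈ rankNumericalRange (i + 1) A) : 2 * z.re ≤ lam i := by
  obtain ⟨S, hS, hform⟩ := mem_rankNumericalRange_iff_exists_submodule.1 hz
  have hH : (A + Aᴴ).IsHermitian := isHermitian_add_transpose_self A
  let T := toEuclideanCLM (n := Fin n) (𝕜 := ℂ)
  refine le_of_card_eigenvalues_lt_finrank (T := (T (A + Aᴴ) : _ →ₗ[ℂ] _)) hH.eigenvectorBasis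
    (lam := hH.eigenvalues) (S := S) (fun j => ?_) ?_ fun w hw => le_of_eq ?_
  · exact congrArg (WithLp.toLp 2) (hH.mulVec_eigenvectorBasis j)
  · rw [hS]
    exact Nat.lt_succ_of_le (card_eigenvalues_gt_le hH hlam hchar i)
  · have hAH : ⟪w, T Aᴴ w⟫_ℂ = star ⟪w, T A w⟫_ℂ := by
      rw [← star_eq_conjTranspose, map_star, ContinuousLinearMap.star_eq_adjoint,
        ContinuousLinearMap.adjoint_inner_right, RCLike.star_def, inner_conj_symm]
    have hre : (⟪w, T A w⟫_ℂ).re = z.re * ‖w‖ ^ 2 := by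
      rw [hform w hw w hw, inner_self_eq_norm_sq_to_K]
      norm_cast
      exact Complex.re_mul_ofReal _ _
    calc 2 * z.re * ‖w‖ ^ 2 = (⟪w, T A w⟫_ℂ).re + (star ⟪w, T A w⟫_ℂ).re := by
          rw [Complex.star_def, Complex.conj_re, hre]; ring
      _ = (⟪w, T (A + Aᴴ) w⟫_ℂ).re := by
          rw [map_add, _root_.add_apply, inner_add_right, hAH, Complex.add_re]

end General

theorem charpoly_nilpotentFour_add_conjTranspose {b c a d : ℝ} (hbc : b ^ 2 + c ^ 2 = 1)
    (hsum : a ^ 2 + d ^ 2 = 2) (hprod : a ^ 2 * d ^ 2 = b ^ 2) :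
    (nilpotentFour b c + (nilpotentFour b c)ᴴ).charpoly =
      ∏ j, (X - C ((![a, d, -d, -a] j : ℝ) : ℂ)) := by
  have hbc' : (b : ℂ) ^ 2 + c ^ 2 = 1 := by exact_mod_cast hbc
  have hsum' : (a : ℂ) ^ 2 + d ^ 2 = 2 := by exact_mod_cast hsum
  have hprod' : (a : ℂ) ^ 2 * d ^ 2 = b ^ 2 := by exact_mod_cast hprod
  refine Polynomial.funext fun x => ?_
  have hdet : (nilpotentFour b c + (nilpotentFour b c)ᴴ).charpoly.eval x
      = x ^ 4 - (1 + (b ^ 2 + c ^ 2)) * x ^ 2 + b ^ 2 := by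
    rw [eval_charpoly]
    simp [nilpotentFour, det_succ_row_zero, Fin.sum_univ_succ, Fin.succAbove]
    ring
  rw [hdet, eval_prod]
  simp only [Fin.prod_univ_four, eval_sub, eval_X, eval_C, cons_val, Complex.ofReal_neg]
  linear_combination x ^ 2 * (hsum' - hbc') - hprod'

theorem charpoly_nilpotentFive_add_conjTranspose {b c s t a d : ℝ} (hbc : b ^ 2 + c ^ 2 = 1)
    (hst : s ^ 2 + t ^ 2 = 1) (h0 : b * c * s * t = 0) (hsum : a ^ 2 + d ^ 2 = 3)
    (hprod : a ^ 2 * d ^ 2 = 2 - (c * s) ^ 2) :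
    (nilpotentFive b c s t + (nilpotentFive b c s t)ᴴ).charpoly =
      ∏ j, (X - C ((![a, d, 0, -d, -a] j : ℝ) : ℂ)) := by
  have hbc' : (b : ℂ) ^ 2 + c ^ 2 = 1 := by exact_mod_cast hbc
  have hst' : (s : ℂ) ^ 2 + t ^ 2 = 1 := by exact_mod_cast hst
  have h0' : (b : ℂ) * c * s * t = 0 := by exact_mod_cast h0
  have hsum' : (a : ℂ) ^ 2 + d ^ 2 = 3 := by exact_mod_cast hsum
  have hprod' : (a : ℂ) ^ 2 * d ^ 2 = 2 - (c * s) ^ 2 := by exact_mod_cast hprod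
  refine Polynomial.funext fun x => ?_
  have hdet : (nilpotentFive b c s t + (nilpotentFive b c s t)ᴴ).charpoly.eval x
      = x ^ 5 - 3 * x ^ 3 + (2 - (c * s) ^ 2) * x := by
    rw [eval_charpoly]
    simp [nilpotentFive, det_succ_row_zero, Fin.sum_univ_succ, Fin.succAbove]
    linear_combination (-x ^ 3 * (1 + t ^ 2) + x * t ^ 2 * (b ^ 2 + c ^ 2 + 1) + x) * hbc' +
      (-x ^ 3 + x + x * c ^ 2) * hst' + 2 * h0'
  rw [hdet, eval_prod]
  simp only [Fin.prod_univ_five, eval_sub, eval_X, eval_C, cons_val, Complex.ofReal_neg,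
    Complex.ofReal_zero]
  linear_combination x ^ 3 * hsum' - x * hprod'

theorem exists_ne_zero_sq_quadratic_eq {p q r e : ℝ} (hp : p ≠ 0) (hr : r ≠ 0) (hq : 0 ≤ q)
    (he : 0 ≤ e) (h : p * r ≤ q ^ 2 + e) :
    ∃ m : ℝ, m ≠ 0 ∧ (p * m ^ 2 + 2 * q * m + r) ^ 2 = 4 * e * m ^ 2 := by
  have hdiscrim : discrim p (2 * (q + √e)) r =
      √(discrim p (2 * (q + √e)) r) * √(discrim p (2 * (q + √e)) r) := by
    refine (Real.mul_self_sqrt ?_).symm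
    rw [discrim]
    nlinarith [Real.sq_sqrt he, mul_nonneg hq (Real.sqrt_nonneg e)]
  obtain ⟨m, hm⟩ := exists_quadratic_eq_zero hp ⟨_, hdiscrim⟩
  have hroot : p * m ^ 2 + 2 * q * m + r = -2 * √e * m := by linear_combination hm
  refine ⟨m, ?_, ?_⟩
  · rintro rfl
    exact hr (by linear_combination hm)
  · rw [hroot, mul_pow, mul_pow, Real.sq_sqrt he]
    ring

section NilpotentFour

variable {b c x : ℝ}

theorem nilpotentFour_eq_map (b c : ℝ) : nilpotentFour b c =
    (!![0, 0, 1, 0; 0, 0, 0, b; 0, 0, 0, c; 0, 0, 0, 0] : Matrix (Fin 4) (Fin 4) ℝ).map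
      Complex.ofReal := by
  ext i j
  fin_cases i <;> fin_cases j <;> simp [nilpotentFour]

theorem ofReal_mem_rankNumericalRange_nilpotentFour_one_zero (hx0 : 0 < x) (hx : 2 * x ≤ 1) :
    (x : ℂ) ∈ rankNumericalRange 2 (nilpotentFour 1 0) := by
  obtain ⟨h, hh⟩ : ∃ h : ℝ, x * (h * h) + -1 * h + x = 0 :=
    exists_quadratic_eq_zero hx0.ne' ⟨√(1 - 4 * x * x), by
      rw [Real.mul_self_sqrt (by nlinarith), discrim]; ring⟩
  rw [nilpotentFour_eq_map]
  refine ofReal_mem_rankNumericalRange_two_of_orthogonal (v := ![1, 0, h, 0]) (w := ![0, 1, 0, h])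
    (fun h => one_ne_zero (congrFun h 0)) (fun h => one_ne_zero (congrFun h 1)) ?_ ?_ ?_ ?_ ?_
  all_goals simp only [mulVec, dotProduct, Fin.sum_univ_four, of_apply, cons_val]
  · ring
  · linear_combination -hh
  · linear_combination -hh
  · ring
  · ring

theorem ofReal_mem_rankNumericalRange_nilpotentFour_of_root {m : ℝ} (hbc : b ^ 2 + c ^ 2 = 1)
    (hc : c ≠ 0) (hx : x ≠ 0) (hm : m ≠ 0)
    (hroot : (4 * x ^ 2 * m ^ 2 + 2 * b * m + 4 * x ^ 2) ^ 2 =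
      4 * ((1 - 4 * x ^ 2) ^ 2 - c ^ 2) * m ^ 2) :
    (x : ℂ) ∈ rankNumericalRange 2 (nilpotentFour b c) := by
  -- For all `m` and `K` the vectors `v` and `w` below are orthogonal and satisfy
  -- `v ⬝ᵥ M *ᵥ w = w ⬝ᵥ M *ᵥ v = 0`. Both Rayleigh quotients equal `x` iff `K = x * (1 - m ^ 2)`
  -- and `hK2` holds; `hroot` is what remains after eliminating `K`.
  obtain ⟨D, hD⟩ : ∃ D, D = (b + m) ^ 2 + c ^ 2 := ⟨_, rfl⟩
  obtain ⟨K, hK⟩ : ∃ K, K = x * (1 - m ^ 2) := ⟨_, rfl⟩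
  have hD' : D = 1 + 2 * b * m + m ^ 2 := by linear_combination hD + hbc
  have hD0 : D ≠ 0 := hD ▸ by positivity
  have hK2 : K ^ 2 = -m * (b * m ^ 2 + 2 * m + b) := by
    refine mul_left_cancel₀ (pow_ne_zero 2 hx) ?_
    rw [hK]
    linear_combination (hroot - 4 * m ^ 2 * hbc) / 16
  rw [nilpotentFour_eq_map]
  refine ofReal_mem_rankNumericalRange_two_of_orthogonal (v := ![-m * D, -c * K, (b + m) * K, 0])
    (w := ![0, (b + m) * K, c * K, D])
    (fun h => mul_ne_zero (neg_ne_zero.2 hm) hD0 (congrFun h 0))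
    (fun h => hD0 (congrFun h 3)) ?_ ?_ ?_ ?_ ?_
  all_goals simp only [mulVec, dotProduct, Fin.sum_univ_four, of_apply, cons_val]
  · ring
  · linear_combination x * K ^ 2 * hD - m * D * (b + m) * hK - x * D * m ^ 2 * hD' - x * D * hK2
  · linear_combination x * K ^ 2 * hD + D * (1 + b * m) * hK + K * D * hbc - x * D * hK2
      - x * D * hD'
  · ring
  · ring

theorem ofReal_mem_rankNumericalRange_nilpotentFour (hb : 0 ≤ b) (hc : 0 ≤ c)
    (hbc : b ^ 2 + c ^ 2 = 1) (hx0 : 0 ≤ x) (hx : 4 * x ^ 2 ≤ 1 - c) :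
    (x : ℂ) ∈ rankNumericalRange 2 (nilpotentFour b c) := by
  rcases hx0.eq_or_lt with rfl | hxpos
  · refine zero_mem_rankNumericalRange_of_submatrix_eq_zero (f := ![0, 1]) (by decide) ?_
    ext i j
    fin_cases i <;> fin_cases j <;> rfl
  rcases hc.eq_or_lt with rfl | hcpos
  · obtain rfl : b = 1 := by nlinarith
    exact ofReal_mem_rankNumericalRange_nilpotentFour_one_zero hxpos (by nlinarith)
  have hX : 0 < 4 * x ^ 2 := by positivity
  obtain ⟨m, hm, hroot⟩ := exists_ne_zero_sq_quadratic_eq (e := (1 - 4 * x ^ 2) ^ 2 - c ^ 2)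
    hX.ne' hX.ne' hb (by nlinarith) (by nlinarith)
  exact ofReal_mem_rankNumericalRange_nilpotentFour_of_root hbc hcpos.ne' hxpos.ne' hm hroot

end NilpotentFour

section NilpotentFive

variable {b c s t x : ℝ}

theorem nilpotentFive_one_zero_eq_map (b c : ℝ) : nilpotentFive b c 1 0 =
    (!![0, 0, 1, 0, 0; 0, 0, 0, b, 0; 0, 0, 0, c, 0; 0, 0, 0, 0, 1; 0, 0, 0, 0, 0] :
      Matrix (Fin 5) (Fin 5) ℝ).map Complex.ofReal := by
  ext i j
  fin_cases i <;> fin_cases j <;> simp [nilpotentFive]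

theorem ofReal_mem_rankNumericalRange_nilpotentFive_one_zero_of_root {m : ℝ}
    (hbc : b ^ 2 + c ^ 2 = 1) (hc : c ≠ 0) (hx : x ≠ 0) (hm : m ≠ 0)
    (hroot : (4 * x ^ 2 * m ^ 2 + 2 * b * m + -(1 - 4 * x ^ 2)) ^ 2 =
      4 * ((1 - 4 * x ^ 2) * (2 - 4 * x ^ 2) - c ^ 2) * m ^ 2) :
    (x : ℂ) ∈ rankNumericalRange 2 (nilpotentFive b c 1 0) := by
  -- The plane is found as for `nilpotentFour`, with `K` rescaled. The ratio `w 4 = w 3 / (2 * x)`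
  -- is the one that maximizes the contribution `w 3 * w 4 - x * w 4 ^ 2` of the last coordinate.
  obtain ⟨D, hD⟩ : ∃ D, D = (b + m) ^ 2 + c ^ 2 := ⟨_, rfl⟩
  obtain ⟨K, hK⟩ : ∃ K, K = 1 - 4 * x ^ 2 + 4 * x ^ 2 * m ^ 2 := ⟨_, rfl⟩
  have hD' : D = 1 + 2 * b * m + m ^ 2 := by linear_combination hD + hbc
  have hD0 : D ≠ 0 := hD ▸ by positivity
  have hK2 : K ^ 2 = 4 * m * (b + m) * K - 16 * x ^ 2 * m ^ 2 * D := by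
    rw [hK, hD']
    linear_combination hroot - 4 * m ^ 2 * hbc
  rw [nilpotentFive_one_zero_eq_map]
  refine ofReal_mem_rankNumericalRange_two_of_orthogonal
    (v := ![4 * x * m * D, -c * K, (b + m) * K, 0, 0])
    (w := ![0, -(b + m) * K, -c * K, 4 * x * D, 2 * D])
    (fun h => mul_ne_zero (mul_ne_zero (mul_ne_zero four_ne_zero hx) hm) hD0 (congrFun h 0))
    (fun h => mul_ne_zero two_ne_zero hD0 (congrFun h 4)) ?_ ?_ ?_ ?_ ?_
  all_goals simp only [mulVec, dotProduct, Fin.sum_univ_five, of_apply, cons_val]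
  · ring
  · linear_combination x * K ^ 2 * hD - x * D * hK2
  · linear_combination x * K ^ 2 * hD - 4 * x * D * K * hbc + 4 * x * D * K * hD'
      - 4 * x * D ^ 2 * hK - x * D * hK2
  · ring
  · ring

theorem ofReal_mem_rankNumericalRange_nilpotentFive_one_zero (hb : 0 ≤ b)
    (hbc : b ^ 2 + c ^ 2 = 1) (hc : c ≠ 0) (hx0 : 0 < x) (hx : 4 * x ^ 2 < 1)
    (hcx : c ^ 2 ≤ (1 - 4 * x ^ 2) * (2 - 4 * x ^ 2)) :
    (x : ℂ) ∈ rankNumericalRange 2 (nilpotentFive b c 1 0) := by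
  have hX : 0 < 4 * x ^ 2 := by positivity
  obtain ⟨m, hm, hroot⟩ := exists_ne_zero_sq_quadratic_eq
    (e := (1 - 4 * x ^ 2) * (2 - 4 * x ^ 2) - c ^ 2) hX.ne' (neg_neg_of_pos (sub_pos.2 hx)).ne hb
    (sub_nonneg.2 hcx) (by nlinarith)
  exact ofReal_mem_rankNumericalRange_nilpotentFive_one_zero_of_root hbc hc hx0.ne' hm hroot

theorem rankNumericalRange_nilpotentFour_one_zero_subset {k : ℕ} (ht : 0 ≤ t)
    (hbc : b ^ 2 + c ^ 2 = 1) (hst : s ^ 2 + t ^ 2 = 1) (hcs : c * s = 0) :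
    rankNumericalRange k (nilpotentFour 1 0) ⊆ rankNumericalRange k (nilpotentFive b c s t) := by
  let V : Matrix (Fin 5) (Fin 4) ℂ :=
    !![1, 0, 0, 0; 0, 1, 0, 0; 0, 0, 1, 0; 0, 0, 0, b; 0, 0, 0, c]
  have hct : (t : ℂ) * c = c := by
    rcases mul_eq_zero.1 hcs with rfl | rfl
    · simp
    · rw [show t = 1 by nlinarith, Complex.ofReal_one, one_mul]
  have hcbt : (c : ℂ) * b + -(t * b * c) = 0 := by linear_combination -(b : ℂ) * hct
  have hbsc : (b = 0 ∨ s = 0) ∨ c = 0 := (mul_eq_zero.1 hcs).elim Or.inr (Or.inl ∘ Or.inr)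
  have hbc' : (b : ℂ) * b + c * c = 1 := by exact_mod_cast (by linarith : b * b + c * c = 1)
  have hV : Vᴴ * V = 1 := by
    ext i j
    fin_cases i <;> fin_cases j <;> simp [V, Matrix.mul_apply, Fin.sum_univ_succ, hbc']
  have hcompress : Vᴴ * nilpotentFive b c s t * V = nilpotentFour 1 0 := by
    ext i j
    fin_cases i <;> fin_cases j <;>
      simp [V, nilpotentFive, nilpotentFour, Matrix.mul_apply, Fin.sum_univ_succ, hct, hbc', hcbt,
        hbsc]
  exact hcompress ▸ rankNumericalRange_conjTranspose_mul_mul_subset hV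

theorem unitarilySimilar_conjTranspose_nilpotentFive (hst : s ^ 2 + t ^ 2 = 1) :
    UnitarilySimilar (nilpotentFive t s 1 0) (nilpotentFive 0 1 s t)ᴴ := by
  have hst' : (s : ℂ) * s + t * t = 1 := by exact_mod_cast (by linarith : s * s + t * t = 1)
  have hts' : (t : ℂ) * t + s * s = 1 := by rw [add_comm, hst']
  let Q : Matrix (Fin 5) (Fin 5) ℂ :=
    !![0, 0, 0, 0, 1;
       0, -(s : ℂ), (t : ℂ), 0, 0;
       0, 0, 0, 1, 0;
       0, (t : ℂ), (s : ℂ), 0, 0;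
       1, 0, 0, 0, 0]
  have hQ : star Q * Q = 1 := by
    ext i j
    fin_cases i <;> fin_cases j <;>
      simp [Q, Matrix.mul_apply, Fin.sum_univ_succ, star_apply, hst', hts', mul_comm]
  have hcomm : Q * nilpotentFive t s 1 0 = (nilpotentFive 0 1 s t)ᴴ * Q := by
    ext i j
    fin_cases i <;> fin_cases j <;>
      simp [Q, nilpotentFive, Matrix.mul_apply, Fin.sum_univ_succ, conjTranspose_apply, mul_comm,
        hts']
  refine ⟨Q, mem_unitaryGroup_iff'.2 hQ, ?_⟩
  rw [Matrix.mul_assoc, ← hcomm, ← Matrix.mul_assoc, hQ, Matrix.one_mul]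

theorem ofReal_mem_rankNumericalRange_nilpotentFive_zero_one {k : ℕ} (hst : s ^ 2 + t ^ 2 = 1)
    (hx : (x : ℂ) ∈ rankNumericalRange k (nilpotentFive t s 1 0)) :
    (x : ℂ) ∈ rankNumericalRange k (nilpotentFive 0 1 s t) := by
  rw [(unitarilySimilar_conjTranspose_nilpotentFive hst).rankNumericalRange_eq] at hx
  simpa using star_mem_rankNumericalRange_conjTranspose hx

theorem ofReal_mem_rankNumericalRange_nilpotentFive (hb : 0 ≤ b) (hc : 0 ≤ c) (hs : 0 ≤ s)
    (ht : 0 ≤ t) (hst : s ^ 2 + t ^ 2 = 1) (hbc : b ^ 2 + c ^ 2 = 1) (h0 : b * c * s * t = 0)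
    (hx0 : 0 ≤ x) (hx : 4 * x ^ 2 ≤ 1) (hcx : (c * s) ^ 2 ≤ (1 - 4 * x ^ 2) * (2 - 4 * x ^ 2)) :
    (x : ℂ) ∈ rankNumericalRange 2 (nilpotentFive b c s t) := by
  rcases hx0.eq_or_lt with rfl | hxpos
  · refine zero_mem_rankNumericalRange_of_submatrix_eq_zero (f := ![0, 1]) (by decide) ?_
    ext i j
    fin_cases i <;> fin_cases j <;> rfl
  by_cases hcs : c * s = 0
  · exact rankNumericalRange_nilpotentFour_one_zero_subset ht hbc hst hcs
      (ofReal_mem_rankNumericalRange_nilpotentFour_one_zero hxpos (by nlinarith))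
  have hx1 : 4 * x ^ 2 < 1 := by
    have hcs2 : 0 < (c * s) ^ 2 := sq_pos_of_ne_zero hcs
    nlinarith
  obtain ⟨hc0, hs0⟩ := mul_ne_zero_iff.1 hcs
  have hbt : b * t = 0 := (mul_eq_zero.1 (show c * s * (b * t) = 0 by linarith)).resolve_left hcs
  rcases mul_eq_zero.1 hbt with rfl | rfl
  · obtain rfl : c = 1 := by nlinarith
    exact ofReal_mem_rankNumericalRange_nilpotentFive_zero_one hst
      (ofReal_mem_rankNumericalRange_nilpotentFive_one_zero ht (by linarith) hs0 hxpos hx1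
        (by simpa using hcx))
  · obtain rfl : s = 1 := by nlinarith
    exact ofReal_mem_rankNumericalRange_nilpotentFive_one_zero hb hbc hc0 hxpos hx1
      (by simpa using hcx)

end NilpotentFive

section Radii

variable {b c s t a d : ℝ} {z : ℂ}

theorem isGradedBy_nilpotentFour (b c : ℝ) : IsGradedBy (nilpotentFour b c) ![0, 1, 1, 2] := by
  intro i j
  fin_cases i <;> fin_cases j <;> simp [nilpotentFour]

theorem two_mul_re_le_of_mem_rankNumericalRange_nilpotentFour (hbc : b ^ 2 + c ^ 2 = 1)
    (hd : 0 ≤ d) (hda : d ≤ a) (hsum : a ^ 2 + d ^ 2 = 2) (hprod : a ^ 2 * d ^ 2 = b ^ 2)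
    {i : Fin 4} (hz : z ∈ rankNumericalRange (i + 1) (nilpotentFour b c)) :
    2 * z.re ≤ ![a, d, -d, -a] i := by
  refine two_mul_re_le_of_mem_rankNumericalRange (Fin.antitone_iff_succ_le.2 fun j => ?_)
    (charpoly_nilpotentFour_add_conjTranspose hbc hsum hprod) hz
  fin_cases j <;> simp <;> linarith

theorem exists_sq_add_sq_eq_two (hc : 0 ≤ c) (hbc : b ^ 2 + c ^ 2 = 1) :
    ∃ a d : ℝ, √(1 / 4 - √(1 / 16 - b ^ 2 / 16)) = d / 2 ∧ 0 ≤ d ∧ d ≤ a ∧ d ^ 2 = 1 - c ∧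
      a ^ 2 + d ^ 2 = 2 ∧ a ^ 2 * d ^ 2 = b ^ 2 := by
  have hinner : √(1 / 16 - b ^ 2 / 16) = c / 4 :=
    (Real.sqrt_eq_iff_eq_sq (by nlinarith) (by positivity)).2 (by linear_combination -hbc / 16)
  have ha : √(1 + c) ^ 2 = 1 + c := Real.sq_sqrt (by positivity)
  have hd : √(1 - c) ^ 2 = 1 - c := Real.sq_sqrt (by nlinarith)
  refine ⟨√(1 + c), √(1 - c), ?_, Real.sqrt_nonneg _, by gcongr; linarith, hd, ?_, ?_⟩
  · rw [hinner, show 1 / 4 - c / 4 = (√(1 - c) / 2) ^ 2 by linear_combination -hd / 4,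
      Real.sqrt_sq (by positivity)]
  · rw [ha, hd]; ring
  · rw [ha, hd]; linear_combination -hbc

theorem rankNumericalRange_two_nilpotentFour (hb : 0 ≤ b) (hc : 0 ≤ c)
    (hbc : b ^ 2 + c ^ 2 = 1) : rankNumericalRange 2 (nilpotentFour b c) =
      Metric.closedBall 0 √(1 / 4 - √(1 / 16 - b ^ 2 / 16)) := by
  obtain ⟨a, d, hr, hd, hda, hdc, hsum, hprod⟩ := exists_sq_add_sq_eq_two hc hbc
  rw [hr]
  refine (isGradedBy_nilpotentFour b c).rankNumericalRange_eq_closedBall (fun z hz => ?_)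
    fun x hx hxr => ofReal_mem_rankNumericalRange_nilpotentFour hb hc hbc hx (by nlinarith)
  have hle : 2 * z.re ≤ d :=
    two_mul_re_le_of_mem_rankNumericalRange_nilpotentFour hbc hd hda hsum hprod (i := 1) hz
  linarith

theorem rankNumericalRange_three_nilpotentFour (hc : 0 ≤ c) (hbc : b ^ 2 + c ^ 2 = 1)
    (hb : b ≠ 0) : rankNumericalRange 3 (nilpotentFour b c) = ∅ := by
  obtain ⟨a, d, -, hd, hda, -, hsum, hprod⟩ := exists_sq_add_sq_eq_two hc hbc
  have hdpos : 0 < d := hd.lt_of_ne' (by rintro rfl; exact hb (by simpa using hprod.symm))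
  refine (isGradedBy_nilpotentFour b c).rankNumericalRange_eq_empty fun z hz => ?_
  have hle : 2 * z.re ≤ -d :=
    two_mul_re_le_of_mem_rankNumericalRange_nilpotentFour hbc hd hda hsum hprod (i := 2) hz
  linarith

theorem exists_isGradedBy_nilpotentFive (h : b * c * s * t = 0) :
    ∃ d, IsGradedBy (nilpotentFive b c s t) d := by
  obtain rfl | rfl | rfl | rfl : b = 0 ∨ c = 0 ∨ s = 0 ∨ t = 0 := by
    simpa only [mul_eq_zero, or_assoc] using h
  · exact ⟨![0, 2, 1, 2, 3], fun i j => by fin_cases i <;> fin_cases j <;> simp [nilpotentFive]⟩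
  · exact ⟨![0, 0, 1, 1, 2], fun i j => by fin_cases i <;> fin_cases j <;> simp [nilpotentFive]⟩
  · exact ⟨![0, 1, 1, 2, 2], fun i j => by fin_cases i <;> fin_cases j <;> simp [nilpotentFive]⟩
  · exact ⟨![0, 1, 1, 2, 3], fun i j => by fin_cases i <;> fin_cases j <;> simp [nilpotentFive]⟩

theorem zero_mem_rankNumericalRange_three_nilpotentFive (h : b * c * s * t = 0) :
    0 ∈ rankNumericalRange 3 (nilpotentFive b c s t) := by
  obtain rfl | rfl | rfl | rfl : b = 0 ∨ c = 0 ∨ s = 0 ∨ t = 0 := by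
    simpa only [mul_eq_zero, or_assoc] using h
  · refine zero_mem_rankNumericalRange_of_submatrix_eq_zero (f := ![0, 1, 3]) (by decide) ?_
    ext i j
    fin_cases i <;> fin_cases j <;> simp [nilpotentFive]
  · refine zero_mem_rankNumericalRange_of_submatrix_eq_zero (f := ![0, 1, 4]) (by decide) ?_
    ext i j
    fin_cases i <;> fin_cases j <;> simp [nilpotentFive]
  · refine zero_mem_rankNumericalRange_of_submatrix_eq_zero (f := ![0, 3, 4]) (by decide) ?_
    ext i j
    fin_cases i <;> fin_cases j <;> simp [nilpotentFive]
  · refine zero_mem_rankNumericalRange_of_submatrix_eq_zero (f := ![0, 1, 4]) (by decide) ?_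
    ext i j
    fin_cases i <;> fin_cases j <;> simp [nilpotentFive]

theorem two_mul_re_le_of_mem_rankNumericalRange_nilpotentFive (hbc : b ^ 2 + c ^ 2 = 1)
    (hst : s ^ 2 + t ^ 2 = 1) (h0 : b * c * s * t = 0) (hd : 0 ≤ d) (hda : d ≤ a)
    (hsum : a ^ 2 + d ^ 2 = 3) (hprod : a ^ 2 * d ^ 2 = 2 - (c * s) ^ 2)
    {i : Fin 5} (hz : z ∈ rankNumericalRange (i + 1) (nilpotentFive b c s t)) :
    2 * z.re ≤ ![a, d, 0, -d, -a] i := by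
  refine two_mul_re_le_of_mem_rankNumericalRange (Fin.antitone_iff_succ_le.2 fun j => ?_)
    (charpoly_nilpotentFive_add_conjTranspose hbc hst h0 hsum hprod) hz
  fin_cases j <;> simp <;> linarith

theorem exists_sq_add_sq_eq_three (hbc : b ^ 2 + c ^ 2 = 1) (hst : s ^ 2 + t ^ 2 = 1) :
    ∃ a d : ℝ, √((3 - √(5 - 4 * (b ^ 2 + c ^ 2 * t ^ 2))) / 2) = d ∧ 0 < d ∧ d ≤ a ∧
      a ^ 2 + d ^ 2 = 3 ∧ a ^ 2 * d ^ 2 = 2 - (c * s) ^ 2 := by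
  have hcs : (c * s) ^ 2 ≤ 1 := by
    rw [mul_pow]
    exact mul_le_one₀ (by nlinarith) (sq_nonneg s) (by nlinarith)
  rw [show 5 - 4 * (b ^ 2 + c ^ 2 * t ^ 2) = 1 + 4 * (c * s) ^ 2 by
    linear_combination -4 * hbc - 4 * c ^ 2 * hst]
  have hq : √(1 + 4 * (c * s) ^ 2) ^ 2 = 1 + 4 * (c * s) ^ 2 := Real.sq_sqrt (by positivity)
  have hq0 := Real.sqrt_nonneg (1 + 4 * (c * s) ^ 2)
  set q := √(1 + 4 * (c * s) ^ 2)
  have hq3 : q < 3 := by nlinarith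
  have ha : √((3 + q) / 2) ^ 2 = (3 + q) / 2 := Real.sq_sqrt (by positivity)
  have hd : √((3 - q) / 2) ^ 2 = (3 - q) / 2 := Real.sq_sqrt (by linarith)
  refine ⟨√((3 + q) / 2), _, rfl, Real.sqrt_pos.2 (by linarith), by gcongr; linarith, ?_, ?_⟩
  · rw [ha, hd]; ring
  · rw [ha, hd]; linear_combination -hq / 4

theorem rankNumericalRange_two_nilpotentFive (hb : 0 ≤ b) (hc : 0 ≤ c) (hs : 0 ≤ s) (ht : 0 ≤ t)
    (hst : s ^ 2 + t ^ 2 = 1) (hbc : b ^ 2 + c ^ 2 = 1) (h0 : b * c * s * t = 0) :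
    rankNumericalRange 2 (nilpotentFive b c s t) =
      Metric.closedBall 0 (1 / 2 * √((3 - √(5 - 4 * (b ^ 2 + c ^ 2 * t ^ 2))) / 2)) := by
  obtain ⟨a, d, hr, hd, hda, hsum, hprod⟩ := exists_sq_add_sq_eq_three hbc hst
  obtain ⟨f, hf⟩ := exists_isGradedBy_nilpotentFive h0
  have hcs : (c * s) ^ 2 = (1 - d ^ 2) * (2 - d ^ 2) := by linear_combination hprod - d ^ 2 * hsum
  have hd1 : d ^ 2 ≤ 1 := by
    have hda2 : d ^ 2 ≤ a ^ 2 := by gcongr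
    nlinarith [sq_nonneg (c * s)]
  rw [hr]
  refine hf.rankNumericalRange_eq_closedBall (fun z hz => ?_) fun x hx hxr => ?_
  · have hle : 2 * z.re ≤ d := two_mul_re_le_of_mem_rankNumericalRange_nilpotentFive hbc hst h0
      hd.le hda hsum hprod (i := 1) hz
    linarith
  · have hxd : 4 * x ^ 2 ≤ d ^ 2 := by nlinarith
    refine ofReal_mem_rankNumericalRange_nilpotentFive hb hc hs ht hst hbc h0 hx
      (hxd.trans hd1) ?_
    rw [hcs]
    gcongr <;> linarith

theorem rankNumericalRange_three_nilpotentFive (hst : s ^ 2 + t ^ 2 = 1)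
    (hbc : b ^ 2 + c ^ 2 = 1) (h0 : b * c * s * t = 0) :
    rankNumericalRange 3 (nilpotentFive b c s t) = {0} := by
  obtain ⟨a, d, -, hd, hda, hsum, hprod⟩ := exists_sq_add_sq_eq_three hbc hst
  obtain ⟨f, hf⟩ := exists_isGradedBy_nilpotentFive h0
  rw [← Metric.closedBall_zero]
  refine hf.rankNumericalRange_eq_closedBall (fun z hz => ?_) fun x hx hxr => ?_
  · have hle : 2 * z.re ≤ 0 := two_mul_re_le_of_mem_rankNumericalRange_nilpotentFive hbc hst h0
      hd.le hda hsum hprod (i := 2) hz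
    linarith
  · obtain rfl : x = 0 := le_antisymm hxr hx
    exact zero_mem_rankNumericalRange_three_nilpotentFive h0

theorem rankNumericalRange_four_nilpotentFive (hst : s ^ 2 + t ^ 2 = 1)
    (hbc : b ^ 2 + c ^ 2 = 1) (h0 : b * c * s * t = 0) :
    rankNumericalRange 4 (nilpotentFive b c s t) = ∅ := by
  obtain ⟨a, d, -, hd, hda, hsum, hprod⟩ := exists_sq_add_sq_eq_three hbc hst
  obtain ⟨f, hf⟩ := exists_isGradedBy_nilpotentFive h0
  refine hf.rankNumericalRange_eq_empty fun z hz => ?_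
  have hle : 2 * z.re ≤ -d := two_mul_re_le_of_mem_rankNumericalRange_nilpotentFive hbc hst h0
    hd.le hda hsum hprod (i := 3) hz
  linarith

end Radii

theorem mainTheorem8 :
    (∀ (b c : ℝ), 0 ≤ b → 0 ≤ c → b ^ 2 + c ^ 2 = 1 →
      ∀ A : Matrix (Fin 4) (Fin 4) ℂ, UnitarilySimilar A (nilpotentFour b c) →
        rankNumericalRange 2 A =
          Metric.closedBall (0 : ℂ) (Real.sqrt (1 / 4 - Real.sqrt (1 / 16 - b ^ 2 / 16))) ∧
        (b ≠ 0 → rankNumericalRange 3 A = ∅)) ∧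
    (∀ (b c s t : ℝ), 0 ≤ b → 0 ≤ c → 0 ≤ s → 0 ≤ t →
      s ^ 2 + t ^ 2 = 1 → b ^ 2 + c ^ 2 = 1 → b * c * s * t = 0 →
      ∀ A : Matrix (Fin 5) (Fin 5) ℂ, UnitarilySimilar A (nilpotentFive b c s t) →
        rankNumericalRange 2 A =
          Metric.closedBall (0 : ℂ)
            (1 / 2 * Real.sqrt ((3 - Real.sqrt (5 - 4 * (b ^ 2 + c ^ 2 * t ^ 2))) / 2)) ∧
        rankNumericalRange 3 A = {0} ∧
        rankNumericalRange 4 A = ∅) := by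
  refine ⟨fun b c hb hc hbc A hA => ?_, fun b c s t hb hc hs ht hst hbc h0 A hA => ?_⟩
  · rw [hA.rankNumericalRange_eq, hA.rankNumericalRange_eq]
    exact ⟨rankNumericalRange_two_nilpotentFour hb hc hbc,
      rankNumericalRange_three_nilpotentFour hc hbc⟩
  · rw [hA.rankNumericalRange_eq, hA.rankNumericalRange_eq, hA.rankNumericalRange_eq]
    exact ⟨rankNumericalRange_two_nilpotentFive hb hc hs ht hst hbc h0,
      rankNumericalRange_three_nilpotentFive hst hbc h0,
      rankNumericalRange_four_nilpotentFive hst hbc h0⟩
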